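/- Let $\theta$ be an irrational real number, let $m\ge 1$ be an integer, and let $G=\mathbb{Z}/m\mathbb{Z}$. Let $\omega\in Z^{3}(G,\mathrm{U}(1))$ be a normalized 3-cocycle for the trivial action of $G$ on $\mathrm{U}(1)$; that is, $\omega:G^{3}\to \mathrm{U}(1)$ satisfies $\omega(g,h,k)=1$ whenever one of $g,h,k$ is the identity, and $$\omega(g_2,g_3,g_4)^{-1}\,\omega(g_1g_2,g_3,g_4)\,\omega(g_1,g_2g_3,g_4)^{-1}\,\omega(g_1,g_2,g_3g_4)\,\omega(g_1,g_2,g_3)^{-1}=1$$ for all $g_1,\dots,g_4\in G$ (the group law of $G$ is written multiplicatively). Let $A_\theta=C(S^1)\rtimes\mathbb{Z}$ be the irrational rotation algebra, i.e. the (reduced) crossed product for the action of $\mathbb{Z}$ on $C(S^1)$ whose generator sends $f$ to the function $z\mapsto f(e^{-2\pi i\theta}z)$. Then there exists an $\omega$-anomalous action of $G$ on $A_\theta$: there are $*$-automorphisms $\alpha_g$ of $A_\theta$ for $g\in G$ and unitaries $m_{g,h}$ in the multiplier algebra $M(A_\theta)$ for $g,h\in G$ such that, for all $g,h,k\in G$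 and all $x\in A_\theta$, $$m_{g,h}\,\alpha_g(\alpha_h(x))=\alpha_{gh}(x)\,m_{g,h},\qquad \omega(g,h,k)\,m_{gh,k}\,m_{g,h}=m_{g,hk}\,\alpha_g(m_{h,k}),$$ where $\alpha_g$ is extended to $M(A_\theta)$. -/

import Mathlib

open scoped ENNReal MultiplierAlgebra
open MeasureTheory Filter

noncomputable section

/-! ### Normalized 3-cocycles with values in `U(1)` (trivial action) -/

/-- `ω : G × G × G → U(1)` lies in `Z³(G, U(1))`: it is a normalized cochain and its coboundary
(for the trivial action of `G` on `U(1)`, written multiplicatively) is trivial. -/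
structure IsThreeCocycle {G : Type*} [Group G] (ω : G → G → G → Circle) : Prop where
  normalized : ∀ g h k : G, g = 1 ∨ h = 1 ∨ k = 1 → ω g h k = 1
  coboundary : ∀ g₁ g₂ g₃ g₄ : G,
    (ω g₂ g₃ g₄)⁻¹ * ω (g₁ * g₂) g₃ g₄ * (ω g₁ (g₂ * g₃) g₄)⁻¹ * ω g₁ g₂ (g₃ * g₄) *
      (ω g₁ g₂ g₃)⁻¹ = 1

/-! ### Extension of automorphisms to the multiplier algebra -/

section Multiplier

variable {B : Type*} [NonUnitalCStarAlgebra B]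

/-- A `*`-automorphism of a C⋆-algebra as a bounded linear map. -/
def autCLM (σ : B ≃⋆ₐ[ℂ] B) : B →L[ℂ] B :=
  LinearMap.mkContinuous
    { toFun := fun x => σ x
      map_add' := fun x y => map_add σ x y
      map_smul' := fun c x => map_smul σ c x } 1
    (fun x => by
      simpa using NonUnitalStarAlgHom.norm_apply_le σ x)

@[simp]
theorem autCLM_apply (σ : B ≃⋆ₐ[ℂ] B) (x : B) : autCLM σ x = σ x := rfl

/-- The extension of a `*`-automorphism `σ` of `B` to the multiplier algebra: the multiplier
`(L, R)` is sent to `(σ L σ⁻¹, σ R σ⁻¹)`. -/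
def multiplierExt (σ : B ≃⋆ₐ[ℂ] B) (u : 𝓜(ℂ, B)) : 𝓜(ℂ, B) where
  toProd := (autCLM σ ∘L u.fst ∘L autCLM σ.symm, autCLM σ ∘L u.snd ∘L autCLM σ.symm)
  central := fun x y => by
    have h := congrArg σ (u.central (σ.symm x) (σ.symm y))
    simpa [map_mul] using h

/-- `multiplierExt σ` does extend `σ` along the canonical embedding `B → M(B)`. -/
theorem multiplierExt_coe (σ : B ≃⋆ₐ[ℂ] B) (b : B) :
    multiplierExt σ (DoubleCentralizer.coe ℂ b) = DoubleCentralizer.coe ℂ (σ b) := by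
  refine DoubleCentralizer.ext ℂ B _ _ (Prod.ext ?_ ?_) <;>
    · ext x
      simp [multiplierExt, map_mul]

end Multiplier

/-! ### Anomalous actions -/

/-- An `ω`-anomalous action of the group `G` on the C⋆-algebra `B`. -/
structure AnomalousAction {G : Type*} [Group G] (ω : G → G → G → Circle)
    (B : Type*) [NonUnitalCStarAlgebra B] where
  /-- the automorphisms `α_g` -/
  aut : G → (B ≃⋆ₐ[ℂ] B)
  /-- the unitary multipliers `m_{g,h}` -/
  mult : G → G → unitary 𝓜(ℂ, B)
  /-- `m_{g,h} α_g(α_h(x)) = α_{gh}(x) m_{g,h}` -/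
  intertwine : ∀ (g h : G) (x : B),
    (mult g h : 𝓜(ℂ, B)) * DoubleCentralizer.coe ℂ (aut g (aut h x)) =
      DoubleCentralizer.coe ℂ (aut (g * h) x) * (mult g h : 𝓜(ℂ, B))
  /-- `ω(g,h,k) m_{gh,k} m_{g,h} = m_{g,hk} α_g(m_{h,k})` -/
  assoc : ∀ g h k : G,
    (ω g h k : ℂ) • ((mult (g * h) k : 𝓜(ℂ, B)) * (mult g h : 𝓜(ℂ, B))) =
      (mult g (h * k) : 𝓜(ℂ, B)) * multiplierExt (aut g) (mult h k : 𝓜(ℂ, B))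

/-! ### Reduced crossed products by discrete groups -/

section CrossedProduct

variable {G : Type*} [Group G] {B : Type*} [CStarAlgebra B]
  {H : Type*} [NormedAddCommGroup H] [InnerProductSpace ℂ H] [CompleteSpace H]

/-- A `*`-representation and a `*`-automorphism are contractive. -/
theorem norm_rep_le (α : G →* (B ≃⋆ₐ[ℂ] B)) (π : B →⋆ₐ[ℂ] (H →L[ℂ] H)) (b : B) (g : G) (x : H) :
    ‖π (α g b) x‖ ≤ ‖b‖ * ‖x‖ := by
  refine (ContinuousLinearMap.le_opNorm _ _).trans ?_
  gcongr
  exact (NonUnitalStarAlgHom.norm_apply_le π _).trans (NonUnitalStarAlgHom.norm_apply_le (α g) b)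

/-- The representation `π̃` of `B` on `ℓ²(G, H)`, `(π̃(b) ξ)(g) = π(α_{g⁻¹}(b)) ξ(g)`. -/
def regularRep (α : G →* (B ≃⋆ₐ[ℂ] B)) (π : B →⋆ₐ[ℂ] (H →L[ℂ] H)) (b : B) :
    lp (fun _ : G => H) 2 →L[ℂ] lp (fun _ : G => H) 2 :=
  LinearMap.mkContinuous
    { toFun := fun ξ => ⟨fun g => π (α g⁻¹ b) (ξ g),
        ((lp.memℓp ξ).norm.const_mul ‖b‖).mono' fun g => by
          simpa using norm_rep_le α π b g⁻¹ (ξ g)⟩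
      map_add' := fun ξ η => by ext g; exact map_add (π (α g⁻¹ b)) (ξ g) (η g)
      map_smul' := fun c ξ => by ext g; exact map_smul (π (α g⁻¹ b)) c (ξ g) } ‖b‖
    (fun ξ => by
      have h := lp.norm_mono (p := 2) (by norm_num)
        (x := (⟨fun g => π (α g⁻¹ b) (ξ g), ((lp.memℓp ξ).norm.const_mul ‖b‖).mono' fun g => by
          simpa using norm_rep_le α π b g⁻¹ (ξ g)⟩ : lp (fun _ : G => H) 2))
        (y := ((‖b‖ : ℂ) • ξ : lp (fun _ : G => H) 2))
        (fun g => by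
          have h' := norm_rep_le α π b g⁻¹ (ξ g)
          rw [lp.coeFn_smul, Pi.smul_apply, norm_smul]
          simpa using h')
      exact h.trans_eq (by rw [norm_smul, Complex.norm_real, norm_norm]))

@[simp]
theorem regularRep_apply (α : G →* (B ≃⋆ₐ[ℂ] B)) (π : B →⋆ₐ[ℂ] (H →L[ℂ] H)) (b : B)
    (ξ : lp (fun _ : G => H) 2) (g : G) : regularRep α π b ξ g = π (α g⁻¹ b) (ξ g) := rfl

/-- The translation operators on `ℓ²(G, H)`, `(λ_s ξ)(g) = ξ(s⁻¹ g)`. -/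
def translation (H : Type*) [NormedAddCommGroup H] [InnerProductSpace ℂ H] (s : G) :
    lp (fun _ : G => H) 2 →L[ℂ] lp (fun _ : G => H) 2 :=
  LinearMap.mkContinuous
    { toFun := fun ξ => ⟨fun g => ξ (s⁻¹ * g), memℓp_gen
        (((lp.memℓp ξ).summable (by norm_num)).comp_injective (mul_right_injective s⁻¹))⟩
      map_add' := fun ξ η => by ext g; rfl
      map_smul' := fun c ξ => by ext g; rfl } 1
    (fun ξ => by
      rw [one_mul, lp.norm_eq_tsum_rpow (by norm_num), lp.norm_eq_tsum_rpow (by norm_num)]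
      exact (congrArg (fun t : ℝ => t ^ (1 / (2 : ℝ≥0∞).toReal))
        ((Equiv.mulLeft s⁻¹).tsum_eq fun g => ‖ξ g‖ ^ (2 : ℝ≥0∞).toReal)).le)

@[simp]
theorem translation_apply (H : Type*) [NormedAddCommGroup H] [InnerProductSpace ℂ H] (s : G)
    (ξ : lp (fun _ : G => H) 2) (g : G) :
    translation H s ξ g = ξ (s⁻¹ * g) := rfl

/-- The reduced crossed product `B ⋊_α G` of a unital C⋆-algebra `B` by an action `α` of the
discrete group `G`, computed in a faithful representation `π` of `B` on a Hilbert space `H` (up to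
isomorphism it does not depend on `π`): the C⋆-algebra of operators on `ℓ²(G, H)` generated by all
`π̃(b)`, `b ∈ B`, and all `λ_s`, `s ∈ G`. -/
def reducedCrossedProduct (α : G →* (B ≃⋆ₐ[ℂ] B)) (π : B →⋆ₐ[ℂ] (H →L[ℂ] H))
    (_hπ : Function.Injective π) :
    StarSubalgebra ℂ (lp (fun _ : G => H) 2 →L[ℂ] lp (fun _ : G => H) 2) :=
  (StarAlgebra.adjoin ℂ
    (Set.range (regularRep α π) ∪ Set.range (translation (G := G) H))).topologicalClosure

end CrossedProduct

/-! ### The irrational rotation algebra -/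

instance : MeasurableSpace Circle := borel Circle

instance : BorelSpace Circle := ⟨rfl⟩

/-- The Haar measure of the circle group `S¹`. -/
abbrev circleHaar : Measure Circle := Measure.haar

/-- Multiplication by `f ∈ C(S¹)` as an operator on `L²(S¹)`. -/
def mulOp (f : C(Circle, ℂ)) : Lp ℂ 2 circleHaar →L[ℂ] Lp ℂ 2 circleHaar :=
  (ContinuousLinearMap.mul ℂ ℂ).holderL circleHaar ∞ 2 2
    (ContinuousMap.toLp ∞ circleHaar ℂ f)

theorem mulOp_coeFn (f : C(Circle, ℂ)) (ξ : Lp ℂ 2 circleHaar) :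
    mulOp f ξ =ᵐ[circleHaar] fun z => f z * ξ z := by
  have h := (ContinuousLinearMap.mul ℂ ℂ).coeFn_holder (r := 2)
    (ContinuousMap.toLp ∞ circleHaar ℂ f) ξ
  refine h.trans ?_
  filter_upwards [ContinuousMap.coeFn_toLp (p := ∞) (𝕜 := ℂ) circleHaar f] with z hz
  rw [hz]
  rfl

/-- `C(S¹)` acting on `L²(S¹)` by multiplication operators. -/
def mulRep : C(Circle, ℂ) →⋆ₐ[ℂ] (Lp ℂ 2 circleHaar →L[ℂ] Lp ℂ 2 circleHaar) where
  toFun := mulOp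
  map_one' := by
    ext1 ξ
    refine Lp.ext ((mulOp_coeFn 1 ξ).trans ?_)
    simp
  map_mul' f g := by
    ext1 ξ
    refine Lp.ext ((mulOp_coeFn (f * g) ξ).trans ?_)
    refine EventuallyEq.trans ?_ (mulOp_coeFn f (mulOp g ξ)).symm
    filter_upwards [mulOp_coeFn g ξ] with z hz
    simp [hz, mul_assoc]
  map_zero' := by simp [mulOp]
  map_add' f g := by simp [mulOp]
  commutes' c := by
    ext1 ξ
    refine Lp.ext ((mulOp_coeFn _ ξ).trans ?_)
    refine EventuallyEq.trans ?_ (Lp.coeFn_smul c ξ).symm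
    filter_upwards with z
    simp [Algebra.algebraMap_eq_smul_one]
  map_star' f := by
    rw [ContinuousLinearMap.star_eq_adjoint, ContinuousLinearMap.eq_adjoint_iff]
    intro ξ η
    rw [L2.inner_def, L2.inner_def]
    refine integral_congr_ae ?_
    filter_upwards [mulOp_coeFn (star f) ξ, mulOp_coeFn f η] with z h₁ h₂
    simp [h₁, h₂]
    ring

theorem mulRep_injective : Function.Injective mulRep := by
  intro f g h
  have h1 : mulOp f (ContinuousMap.toLp 2 circleHaar ℂ 1) =
    mulOp g (ContinuousMap.toLp 2 circleHaar ℂ 1) := DFunLike.congr_fun h _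
  have h2 : f =ᵐ[circleHaar] g := by
    filter_upwards [mulOp_coeFn f (ContinuousMap.toLp 2 circleHaar ℂ 1),
      mulOp_coeFn g (ContinuousMap.toLp 2 circleHaar ℂ 1),
      ContinuousMap.coeFn_toLp (p := 2) (𝕜 := ℂ) circleHaar (1 : C(Circle, ℂ))] with z hf hg h0
    rw [h1] at hf
    rw [hf, h0] at hg
    simpa using hg
  exact DFunLike.coe_injective ((Continuous.ae_eq_iff_eq _ f.continuous g.continuous).1 h2)

/-- The automorphism `f(z) ↦ f(e^{-2πiθ} z)` of `C(S¹)`. -/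
def rotationAut (θ : ℝ) : C(Circle, ℂ) ≃⋆ₐ[ℂ] C(Circle, ℂ) :=
  (Homeomorph.mulLeft (Circle.exp (-(2 * Real.pi * θ)))).compStarAlgEquiv' ℂ ℂ

theorem rotationAut_apply (θ : ℝ) (f : C(Circle, ℂ)) (z : Circle) :
    rotationAut θ f z = f (Circle.exp (-(2 * Real.pi * θ)) * z) := rfl

/-- The action of `ℤ` on `C(S¹)` whose cyclic generator acts by `rotationAut θ`. -/
def rotationAction (θ : ℝ) : Multiplicative ℤ →* (C(Circle, ℂ) ≃⋆ₐ[ℂ] C(Circle, ℂ)) :=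
  zpowersHom _ (rotationAut θ)

/-- The rotation algebra `A_θ = C(S¹) ⋊_θ ℤ`. -/
def rotationAlgebra (θ : ℝ) :
    StarSubalgebra ℂ (lp (fun _ : Multiplicative ℤ => Lp ℂ 2 circleHaar) 2 →L[ℂ]
      lp (fun _ : Multiplicative ℤ => Lp ℂ 2 circleHaar) 2) :=
  reducedCrossedProduct (rotationAction θ) mulRep mulRep_injective

instance (θ : ℝ) : IsClosed (rotationAlgebra θ : Set
    (lp (fun _ : Multiplicative ℤ => Lp ℂ 2 circleHaar) 2 →L[ℂ]
      lp (fun _ : Multiplicative ℤ => Lp ℂ 2 circleHaar) 2)) :=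
  StarSubalgebra.isClosed_topologicalClosure _

end

/-! On a cyclic group, every 3-cocycle is a coboundary times a standard one. Put `P_g(n) = ∏_{i<n}
ω(g,i,1)`. Telescoping the cocycle identity expresses ω through `P`; over a full period, `χ(g) =
P_g(m)` is a character, and ω is a coboundary times `χ(g)^c(h,k)`, where `c` is the carry of adding
residues (`IsThreeCocycle.mul_eq`).

The algebra `A_θ` has a gauge action `β` of the two-torus: `β(s,t)` rotates functions by `s` and
multiplies the translation `λ_k` by `t^k`. The coordinate function is a unitary `u` with `β(s,t)(u)
= s u`, and `β(1, e^{-2πiθ}) = Ad u*`. Let `r` be an m-th root of `e^{-2πiθ}`. Then `α_g = β(χ(g),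
r^g)` is multiplicative up to powers of `r^m`, which are inner, and `m_{g,h} = P_g(h) u^c(g,h)`
intertwines. The anomaly `χ(g)^c(h,k)` is the eigenvalue of `α_g` on `u^c(h,k)`, while the scalars
`P_g(h)` supply the coboundary. -/

noncomputable section

/-! ### Three-cocycles on finite cyclic groups -/

section Cocycle

open Finset Multiplicative

variable {m : ℕ}

/-- The partial products `∏_{i < n} ω(g, i, 1)` of a three-cochain on a cyclic group. -/
def partialProd (ω : Multiplicative (ZMod m) → Multiplicative (ZMod m) →
    Multiplicative (ZMod m) → Circle) (g : Multiplicative (ZMod m)) (n : ℕ) : Circle :=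
  ∏ i ∈ range n, ω g (ofAdd (i : ZMod m)) (ofAdd 1)

variable {ω : Multiplicative (ZMod m) → Multiplicative (ZMod m) →
    Multiplicative (ZMod m) → Circle}

theorem partialProd_succ (g : Multiplicative (ZMod m)) (n : ℕ) :
    partialProd ω g (n + 1) = partialProd ω g n * ω g (ofAdd (n : ZMod m)) (ofAdd 1) :=
  prod_range_succ _ _

theorem partialProd_period_add (g : Multiplicative (ZMod m)) (n : ℕ) :
    partialProd ω g (m + n) = partialProd ω g m * partialProd ω g n := by
  simp [partialProd, prod_range_add]

theorem partialProd_mul_period_add (g : Multiplicative (ZMod m)) (n e : ℕ) :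
    partialProd ω g (n + m * e) = partialProd ω g n * partialProd ω g m ^ e := by
  induction e with
  | zero => simp
  | succ e ih =>
    rw [mul_add_one, ← add_assoc, add_comm, partialProd_period_add, ih, pow_succ, mul_comm,
      mul_assoc]

/-- The telescoped cocycle identity. -/
theorem IsThreeCocycle.eq_partialProd (hω : IsThreeCocycle ω) (g : Multiplicative (ZMod m))
    (n k : ℕ) :
    ω g (ofAdd (n : ZMod m)) (ofAdd (k : ZMod m)) =
      partialProd ω (ofAdd (n : ZMod m)) k / partialProd ω (g * ofAdd (n : ZMod m)) k *
        (partialProd ω g (n + k) / partialProd ω g n) := by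
  induction k with
  | zero => simpa [partialProd] using hω.normalized _ _ _ (.inr (.inr rfl))
  | succ k ih =>
    -- With last entry 1, three of the five factors are exactly those that lengthen the three
    -- partial products.
    have h := hω.coboundary g (ofAdd (n : ZMod m)) (ofAdd (k : ZMod m)) (ofAdd 1)
    rw [ih] at h
    rw [← add_assoc, partialProd_succ, partialProd_succ, partialProd_succ, Nat.cast_add,
      Nat.cast_add, Nat.cast_one, ofAdd_add, ofAdd_add]
    have h' := eq_inv_of_mul_eq_one_left h
    rw [inv_inv] at h'
    generalize ω (ofAdd (n : ZMod m)) (ofAdd (k : ZMod m)) (ofAdd 1) = a at *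
    generalize ω (g * ofAdd (n : ZMod m)) (ofAdd (k : ZMod m)) (ofAdd 1) = b at *
    generalize ω g (ofAdd (n : ZMod m) * ofAdd (k : ZMod m)) (ofAdd 1) = c at *
    generalize ω g (ofAdd (n : ZMod m)) (ofAdd (k : ZMod m) * ofAdd 1) = x at *
    rw [Circle.ext_iff] at h' ⊢
    push_cast at h' ⊢
    field_simp at h' ⊢
    linear_combination h'

/-- Take `k = m` in the telescoped identity: the left side is 1 by normalization, since `m` is the
identity of the group, but the partial products run over a full period. -/
theorem IsThreeCocycle.partialProd_period_mul [NeZero m] (hω : IsThreeCocycle ω)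
    (g h : Multiplicative (ZMod m)) :
    partialProd ω (g * h) m = partialProd ω g m * partialProd ω h m := by
  have key := hω.eq_partialProd g (toAdd h).val m
  rw [hω.normalized _ _ _ (.inr (.inr (by simp))), add_comm, partialProd_period_add] at key
  simp only [ZMod.natCast_val, ZMod.cast_id', id_eq, ofAdd_toAdd, mul_div_cancel_right] at key
  rwa [eq_comm, div_mul_eq_mul_div, div_eq_one, mul_comm, eq_comm] at key

/-- The carry of the addition of two residues. -/
def carry (h k : Multiplicative (ZMod m)) : ℕ := ((toAdd h).val + (toAdd k).val) / m

theorem val_add_val_eq [NeZero m] (h k : Multiplicative (ZMod m)) :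
    (toAdd h).val + (toAdd k).val = (toAdd (h * k)).val + m * carry h k := by
  rw [toAdd_mul, ZMod.val_add, carry, Nat.mod_add_div]

/-- After multiplication by `m`, both sides are the sum of the three representatives minus the
representative of the product. This equates the powers of `u` in the associativity relation. -/
theorem carry_assoc [NeZero m] (g h k : Multiplicative (ZMod m)) :
    carry (g * h) k + carry g h = carry g (h * k) + carry h k := by
  have h1 := val_add_val_eq (g * h) k
  have h2 := val_add_val_eq g h
  have h3 := val_add_val_eq g (h * k)
  have h4 := val_add_val_eq h k
  rw [mul_assoc] at h1
  refine Nat.eq_of_mul_eq_mul_left (Nat.pos_of_ne_zero (NeZero.ne m)) ?_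
  rw [mul_add, mul_add]
  omega

/-- Every three-cocycle on a cyclic group is the product of a coboundary and a standard cocycle. -/
theorem IsThreeCocycle.mul_eq [NeZero m] (hω : IsThreeCocycle ω)
    (g h k : Multiplicative (ZMod m)) :
    ω g h k * (partialProd ω (g * h) (toAdd k).val * partialProd ω g (toAdd h).val) =
      partialProd ω g (toAdd (h * k)).val * partialProd ω h (toAdd k).val *
        partialProd ω g m ^ carry h k := by
  have key := hω.eq_partialProd g (toAdd h).val (toAdd k).val
  -- Each carried multiple of `m` contributes one full-period product.
  rw [val_add_val_eq, partialProd_mul_period_add] at key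
  simp only [ZMod.natCast_val, ZMod.cast_id', id_eq, ofAdd_toAdd] at key
  rw [key, div_mul_div_comm, div_mul_cancel]
  simp only [mul_comm, mul_left_comm]

end Cocycle

/-! ### Anomalous actions of cyclic groups from gauge actions -/

section Gauge

variable {B : Type*} [CStarAlgebra B]

/-- A unitary element of a unital C⋆-algebra, as a unitary multiplier. -/
def unitaryMultiplier (v : unitary B) : unitary 𝓜(ℂ, B) :=
  ⟨DoubleCentralizer.coe ℂ (v : B), by
    have h1 : (1 : 𝓜(ℂ, B)) = DoubleCentralizer.coeHom (𝕜 := ℂ) (1 : B) := by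
      refine DoubleCentralizer.ext ℂ B _ _ (Prod.ext ?_ ?_) <;> ext x <;> simp
    change DoubleCentralizer.coeHom (𝕜 := ℂ) (v : B) ∈ _
    rw [Unitary.mem_iff, ← map_star, ← map_mul, ← map_mul, h1]
    simp⟩

/-- For unital C⋆-algebras the relations of an anomalous action can be checked in the algebra. -/
def AnomalousAction.ofUnital {G : Type*} [Group G] {ω : G → G → G → Circle}
    (aut : G → (B ≃⋆ₐ[ℂ] B)) (v : G → G → unitary B)
    (intertwine : ∀ (g h : G) (x : B), (v g h : B) * aut g (aut h x) = aut (g * h) x * v g h)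
    (assoc : ∀ g h k : G, (ω g h k : ℂ) • ((v (g * h) k : B) * (v g h : B)) =
      (v g (h * k) : B) * aut g (v h k)) : AnomalousAction ω B where
  aut := aut
  mult g h := unitaryMultiplier (v g h)
  intertwine g h x := by
    change DoubleCentralizer.coeHom (𝕜 := ℂ) (v g h : B) *
      DoubleCentralizer.coeHom (𝕜 := ℂ) (aut g (aut h x)) =
      DoubleCentralizer.coeHom (𝕜 := ℂ) (aut (g * h) x) *
        DoubleCentralizer.coeHom (𝕜 := ℂ) (v g h : B)
    rw [← map_mul, ← map_mul, intertwine]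
  assoc g h k := by
    change (ω g h k : ℂ) • (DoubleCentralizer.coeHom (𝕜 := ℂ) (v (g * h) k : B) *
      DoubleCentralizer.coeHom (𝕜 := ℂ) (v g h : B)) =
      DoubleCentralizer.coeHom (𝕜 := ℂ) (v g (h * k) : B) *
        multiplierExt (aut g) (DoubleCentralizer.coe ℂ (v h k : B))
    rw [multiplierExt_coe]
    change _ = DoubleCentralizer.coeHom (𝕜 := ℂ) (v g (h * k) : B) *
      DoubleCentralizer.coeHom (𝕜 := ℂ) (aut g (v h k : B))
    rw [← map_mul, ← map_mul, ← assoc, map_smul]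

/-- A gauge action of the two-torus with an eigenunitary `u` that implements the inverse of the
gauge automorphism at `(1, r ^ m)` gives anomalous actions of `ℤ/m` for all three-cocycles. -/
theorem AnomalousAction.nonempty_of_gauge {m : ℕ} [NeZero m]
    {ω : Multiplicative (ZMod m) → Multiplicative (ZMod m) → Multiplicative (ZMod m) → Circle}
    (hω : IsThreeCocycle ω) (β : Circle → Circle → (B ≃⋆ₐ[ℂ] B))
    (hβ : ∀ s t s' t' x, β s t (β s' t' x) = β (s * s') (t * t') x)
    (u : unitary B) (hu : ∀ s t, β s t u = (s : ℂ) • (u : B))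
    (r : Circle) (hr : ∀ x, (u : B) * β 1 (r ^ m) x = x * u) :
    Nonempty (AnomalousAction ω B) := by
  -- `β 1 1` is not assumed to be the identity here; it is absorbed later, when `x` is itself a
  -- value of `β`.
  have hpow : ∀ (e : ℕ) (x : B), (u : B) ^ e * β 1 (r ^ (m * e)) x = β 1 1 x * (u : B) ^ e := by
    intro e
    induction e with
    | zero => simp
    | succ e ih =>
      intro x
      have h1 : β 1 (r ^ (m * (e + 1))) x = β 1 (r ^ m) (β 1 (r ^ (m * e)) x) := by
        rw [hβ, one_mul, mul_add_one, pow_add, mul_comm]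
      rw [h1, pow_succ, mul_assoc, hr, ← mul_assoc, ih, mul_assoc]
  have hc : ∀ c : Circle, (c : ℂ) • (1 : B) ∈ unitary B := by
    intro c
    rw [Unitary.mem_iff]
    simp [smul_smul, ← Circle.coe_inv_eq_conj]
  refine ⟨AnomalousAction.ofUnital
    (fun g => β (partialProd ω g m) (r ^ (Multiplicative.toAdd g).val))
    (fun g h => ⟨_, hc (partialProd ω g (Multiplicative.toAdd h).val)⟩ * u ^ carry g h) ?_ ?_⟩
  · intro g h x
    -- The first coordinates multiply because full-period products form a character; the second ones
    -- differ by the carry.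
    have h1 : β (partialProd ω g m) (r ^ (Multiplicative.toAdd g).val)
        (β (partialProd ω h m) (r ^ (Multiplicative.toAdd h).val) x) =
        β 1 (r ^ (m * carry g h))
          (β (partialProd ω (g * h) m) (r ^ (Multiplicative.toAdd (g * h)).val) x) := by
      rw [hβ, hβ, ← pow_add, ← pow_add, val_add_val_eq, hω.partialProd_period_mul, one_mul,
        add_comm]
    have h2 := hpow (carry g h)
      (β (partialProd ω (g * h) m) (r ^ (Multiplicative.toAdd (g * h)).val) x)
    rw [hβ 1 1, one_mul, one_mul] at h2
    simp only [Submonoid.coe_mul, SubmonoidClass.coe_pow, smul_mul_assoc, one_mul,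
      mul_smul_comm]
    rw [h1, h2]
  · intro g h k
    have h1 := congrArg ((↑) : Circle → ℂ) (hω.mul_eq g h k)
    have h2 := carry_assoc g h k
    simp only [Circle.coe_mul, Circle.coe_pow] at h1
    simp only [Submonoid.coe_mul, SubmonoidClass.coe_pow, smul_mul_assoc, one_mul,
      mul_smul_comm, map_smul, map_pow, hu, smul_pow, smul_smul, ← pow_add]
    rw [h2, mul_comm (partialProd ω g _ : ℂ) (partialProd ω (g * h) _ : ℂ), h1]
    congr 1
    ring

end Gauge

/-! ### The gauge action on the rotation algebra -/

/-! ### Star automorphisms and relations determined on generators -/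

section Generators

variable {E : Type*} [CStarAlgebra E] {S : Set E}

/-- The restriction of a star automorphism to an invariant star subalgebra. -/
def restrictAut (A : StarSubalgebra ℂ E) (φ ψ : E ≃⋆ₐ[ℂ] E) (hφ : ∀ x ∈ A, φ x ∈ A)
    (hψ : ∀ x ∈ A, ψ x ∈ A) (h1 : ∀ x, ψ (φ x) = x) (h2 : ∀ x, φ (ψ x) = x) : A ≃⋆ₐ[ℂ] A where
  toFun x := ⟨φ x, hφ x x.2⟩
  invFun x := ⟨ψ x, hψ x x.2⟩
  left_inv x := Subtype.ext (h1 x)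
  right_inv x := Subtype.ext (h2 x)
  map_mul' x y := Subtype.ext (map_mul φ (x : E) y)
  map_add' x y := Subtype.ext (map_add φ (x : E) y)
  map_star' x := Subtype.ext (map_star φ (x : E))
  map_smul' c x := Subtype.ext (map_smul φ c (x : E))

theorem continuous_starAlgHom (φ : E →⋆ₐ[ℂ] E) : Continuous φ :=
  AddMonoidHomClass.continuous_of_bound φ 1 fun x => by
    simpa using NonUnitalStarAlgHom.norm_apply_le φ x

theorem adjoin_topologicalClosure_map_mem (φ : E →⋆ₐ[ℂ] E)
    (h : ∀ x ∈ S, φ x ∈ (StarAlgebra.adjoin ℂ S).topologicalClosure) {x : E}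
    (hx : x ∈ (StarAlgebra.adjoin ℂ S).topologicalClosure) :
    φ x ∈ (StarAlgebra.adjoin ℂ S).topologicalClosure := by
  have key : (StarAlgebra.adjoin ℂ S).topologicalClosure ≤
      (StarAlgebra.adjoin ℂ S).topologicalClosure.comap φ :=
    StarSubalgebra.topologicalClosure_minimal (StarAlgebra.adjoin_le h)
      ((StarSubalgebra.isClosed_topologicalClosure _).preimage (continuous_starAlgHom φ))
  exact key hx

/-- The relation says that `φ` agrees with `Ad u*`, and two continuous star homomorphisms agree on a
closed star subalgebra. -/
theorem mul_apply_eq_mul_of_adjoin (φ : E →⋆ₐ[ℂ] E) (u : unitary E)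
    (h : ∀ x ∈ S, (u : E) * φ x = x * u) {x : E}
    (hx : x ∈ (StarAlgebra.adjoin ℂ S).topologicalClosure) : (u : E) * φ x = x * u := by
  have hu : ∀ y : E, (u : E) * φ y = y * u ↔ φ y = Unitary.conjStarAlgAut ℂ E (star u) y := by
    intro y
    rw [Unitary.conjStarAlgAut_star_apply, mul_assoc]
    constructor
    · intro h
      rw [← h, ← mul_assoc, Unitary.coe_star_mul_self, one_mul]
    · intro h
      rw [h, ← mul_assoc, Unitary.mul_star_self_of_mem u.2, one_mul]
  let ψ : E →⋆ₐ[ℂ] E := (Unitary.conjStarAlgAut ℂ E (star u) : E →⋆ₐ[ℂ] E)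
  have key : (StarAlgebra.adjoin ℂ S).topologicalClosure ≤ StarAlgHom.equalizer φ ψ :=
    StarSubalgebra.topologicalClosure_minimal
      (StarAlgHom.adjoin_le_equalizer φ ψ fun y hy => (hu y).1 (h y hy))
      (isClosed_eq (continuous_starAlgHom φ) (continuous_starAlgHom ψ))
  exact (hu x).2 (key hx)

/-- An element of a star subalgebra that is unitary in the ambient algebra. -/
def unitaryOfMem (A : StarSubalgebra ℂ E) (u : unitary E) (hu : (u : E) ∈ A) : unitary A :=
  ⟨⟨u, hu⟩, by
    have h := u.2
    rw [Unitary.mem_iff] at h ⊢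
    exact ⟨Subtype.ext h.1, Subtype.ext h.2⟩⟩

/-- A gauge action of the two-torus by automorphisms that leave a closed star subalgebra `A`
invariant, with an eigenunitary in `A`, gives anomalous actions of `ℤ/m` on `A`. -/
theorem AnomalousAction.nonempty_of_restrict_gauge (A : StarSubalgebra ℂ E)
    [IsClosed (A : Set E)] {m : ℕ} [NeZero m]
    {ω : Multiplicative (ZMod m) → Multiplicative (ZMod m) → Multiplicative (ZMod m) → Circle}
    (hω : IsThreeCocycle ω) (β : Circle → Circle → (E ≃⋆ₐ[ℂ] E))
    (hβ : ∀ s t s' t' x, β s t (β s' t' x) = β (s * s') (t * t') x) (hβ1 : ∀ x, β 1 1 x = x)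
    (hmem : ∀ s t, ∀ x ∈ A, β s t x ∈ A) (u : unitary E) (huA : (u : E) ∈ A)
    (hu : ∀ s t, β s t u = (s : ℂ) • (u : E)) (r : Circle)
    (hr : ∀ x ∈ A, (u : E) * β 1 (r ^ m) x = x * u) : Nonempty (AnomalousAction ω A) :=
  AnomalousAction.nonempty_of_gauge hω
    (fun s t => restrictAut A (β s t) (β s⁻¹ t⁻¹) (hmem s t) (hmem s⁻¹ t⁻¹)
      (fun x => by rw [hβ, inv_mul_cancel, inv_mul_cancel, hβ1])
      (fun x => by rw [hβ, mul_inv_cancel, mul_inv_cancel, hβ1]))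
    (fun s t s' t' x => Subtype.ext (hβ s t s' t' x)) (unitaryOfMem A u huA)
    (fun s t => Subtype.ext (hu s t)) r (fun x => Subtype.ext (hr x x.2))

theorem conjStarAlgEquiv_trans_apply {H : Type*} [NormedAddCommGroup H] [InnerProductSpace ℂ H]
    [CompleteSpace H] (e f : H ≃ₗᵢ[ℂ] H) (x : H →L[ℂ] H) :
    (e.trans f).conjStarAlgEquiv x = f.conjStarAlgEquiv (e.conjStarAlgEquiv x) := rfl

theorem conjStarAlgEquiv_refl_apply {H : Type*} [NormedAddCommGroup H] [InnerProductSpace ℂ H]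
    [CompleteSpace H] (x : H →L[ℂ] H) :
    (LinearIsometryEquiv.refl ℂ H).conjStarAlgEquiv x = x := rfl

theorem conjStarAlgEquiv_eq_of_comp_eq {H : Type*} [NormedAddCommGroup H] [InnerProductSpace ℂ H]
    [CompleteSpace H] (e : H ≃ₗᵢ[ℂ] H) {x y : H →L[ℂ] H} (h : ∀ ξ, e (x ξ) = y (e ξ)) :
    e.conjStarAlgEquiv x = y := by
  ext ξ
  simp [h]

end Generators

/-! ### Gauge unitaries on `ℓ²(ℤ, L²(S¹))` -/

section Rotation

/-- The Hilbert space `L²(S¹)`. -/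
local notation "L2S" => Lp ℂ 2 circleHaar

/-- The Hilbert space `ℓ²(ℤ, L²(S¹))`. -/
local notation "HS" => lp (fun _ : Multiplicative ℤ => Lp ℂ 2 circleHaar) 2

/-- The unitary `ξ ↦ t ξ(s ·)` of `L²(S¹)`. -/
def rotPhase (s t : Circle) : L2S ≃ₗᵢ[ℂ] L2S where
  toFun ξ := (t : ℂ) • (DomMulAct.mk s • ξ)
  invFun ξ := (t⁻¹ : ℂ) • (DomMulAct.mk s⁻¹ • ξ)
  map_add' ξ η := by rw [smul_add, smul_add]
  map_smul' c ξ := by rw [RingHom.id_apply, smul_comm _ c, smul_comm _ c]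
  left_inv ξ := by
    change (t : ℂ)⁻¹ • (DomMulAct.mk s⁻¹ • (t : ℂ) • (DomMulAct.mk s • ξ)) = ξ
    rw [smul_comm (DomMulAct.mk s⁻¹) (t : ℂ), smul_smul, smul_smul, ← DomMulAct.mk_mul,
      inv_mul_cancel₀ (Circle.coe_ne_zero t), mul_inv_cancel, DomMulAct.mk_one, one_smul, one_smul]
  right_inv ξ := by
    change (t : ℂ) • (DomMulAct.mk s • (t : ℂ)⁻¹ • (DomMulAct.mk s⁻¹ • ξ)) = ξ
    rw [smul_comm (DomMulAct.mk s) (t : ℂ)⁻¹, smul_smul, smul_smul, ← DomMulAct.mk_mul,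
      mul_inv_cancel₀ (Circle.coe_ne_zero t), inv_mul_cancel, DomMulAct.mk_one, one_smul, one_smul]
  norm_map' ξ := by
    change ‖(t : ℂ) • (DomMulAct.mk s • ξ)‖ = ‖ξ‖
    rw [norm_smul, DomMulAct.norm_smul_Lp, Circle.norm_coe, one_mul]

theorem rotPhase_apply (s t : Circle) (ξ : L2S) :
    rotPhase s t ξ = (t : ℂ) • (DomMulAct.mk s • ξ) := rfl

theorem rotPhase_mul (s t s' t' : Circle) (ξ : L2S) :
    rotPhase (s * s') (t * t') ξ = rotPhase s t (rotPhase s' t' ξ) := by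
  rw [rotPhase_apply, rotPhase_apply, rotPhase_apply, smul_comm (DomMulAct.mk s), smul_smul,
    smul_smul, ← DomMulAct.mk_mul, mul_comm s, Circle.coe_mul]

theorem rotPhase_one (ξ : L2S) : rotPhase 1 1 ξ = ξ := by
  simp [rotPhase_apply]

/-- The rotate `f(s ·)` of a continuous function. -/
def rotate (s : Circle) (f : C(Circle, ℂ)) : C(Circle, ℂ) :=
  f.comp ⟨fun z => s * z, by fun_prop⟩

theorem rotate_apply (s : Circle) (f : C(Circle, ℂ)) (z : Circle) : rotate s f z = f (s * z) := rfl

theorem mk_smul_ae_eq (s : Circle) (ξ : L2S) :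
    (DomMulAct.mk s • ξ : L2S) =ᵐ[circleHaar] fun z => ξ (s * z) :=
  DomMulAct.smul_Lp_ae_eq _ _

theorem rotPhase_mulOp (s t : Circle) (f : C(Circle, ℂ)) (ξ : L2S) :
    rotPhase s t (mulOp f ξ) = mulOp (rotate s f) (rotPhase s t ξ) := by
  rw [rotPhase_apply, rotPhase_apply, map_smul]
  congr 1
  refine Lp.ext ?_
  have h := (measurePreserving_mul_left circleHaar s).quasiMeasurePreserving.ae_eq_comp
    (mulOp_coeFn f ξ)
  filter_upwards [mk_smul_ae_eq s (mulOp f ξ), mk_smul_ae_eq s ξ, h,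
    mulOp_coeFn (rotate s f) (DomMulAct.mk s • ξ)] with z h1 h2 h3 h4
  rw [h1, h4, h2, rotate_apply]
  exact h3

/-- The diagonal isometry of `ℓ²` given by a family of isometries. -/
def diagIsometry {G H : Type*} [NormedAddCommGroup H] [InnerProductSpace ℂ H]
    (a : G → (H ≃ₗᵢ[ℂ] H)) : lp (fun _ : G => H) 2 ≃ₗᵢ[ℂ] lp (fun _ : G => H) 2 where
  toFun ξ := ⟨fun g => a g (ξ g), (lp.memℓp ξ).norm.mono' fun g => by simp⟩
  invFun ξ := ⟨fun g => (a g).symm (ξ g), (lp.memℓp ξ).norm.mono' fun g => by simp⟩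
  map_add' ξ η := by ext g; exact map_add (a g) (ξ g) (η g)
  map_smul' c ξ := by ext g; exact map_smul (a g) c (ξ g)
  left_inv ξ := by ext g; exact (a g).symm_apply_apply _
  right_inv ξ := by ext g; exact (a g).apply_symm_apply _
  norm_map' ξ := by
    rw [lp.norm_eq_tsum_rpow (by norm_num), lp.norm_eq_tsum_rpow (by norm_num)]
    congr 2 with g
    exact congrArg (· ^ _) ((a g).norm_map (ξ g))

/-- The unitary `(W ξ)(n) = tⁿ ξ(n)(s ·)` of `ℓ²(ℤ, L²(S¹))`. -/
def gaugeUnitary (s t : Circle) : HS ≃ₗᵢ[ℂ] HS :=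
  diagIsometry fun n => rotPhase s (t ^ n.toAdd)

theorem gaugeUnitary_apply (s t : Circle) (ξ : HS) (n : Multiplicative ℤ) :
    gaugeUnitary s t ξ n = rotPhase s (t ^ n.toAdd) (ξ n) := rfl

theorem gaugeUnitary_mul (s t s' t' : Circle) :
    gaugeUnitary (s * s') (t * t') = (gaugeUnitary s' t').trans (gaugeUnitary s t) := by
  ext1 ξ
  refine lp.ext (funext fun n => ?_)
  rw [gaugeUnitary_apply, mul_zpow, rotPhase_mul]
  rfl

theorem gaugeUnitary_one : gaugeUnitary 1 1 = .refl ℂ HS := by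
  ext1 ξ
  refine lp.ext (funext fun n => ?_)
  rw [gaugeUnitary_apply, one_zpow, rotPhase_one]
  rfl

/-- Conjugation by the gauge unitary. -/
def gaugeConj (s t : Circle) : (HS →L[ℂ] HS) ≃⋆ₐ[ℂ] (HS →L[ℂ] HS) :=
  (gaugeUnitary s t).conjStarAlgEquiv

theorem gaugeConj_gaugeConj (s t s' t' : Circle) (x : HS →L[ℂ] HS) :
    gaugeConj s t (gaugeConj s' t' x) = gaugeConj (s * s') (t * t') x := by
  rw [gaugeConj, gaugeConj, gaugeConj, gaugeUnitary_mul]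
  exact (conjStarAlgEquiv_trans_apply _ _ _).symm

theorem gaugeConj_one (x : HS →L[ℂ] HS) : gaugeConj 1 1 x = x := by
  rw [gaugeConj, gaugeUnitary_one]
  exact conjStarAlgEquiv_refl_apply x

theorem rotationAction_apply (θ : ℝ) (n : Multiplicative ℤ) (f : C(Circle, ℂ)) :
    rotationAction θ n f = rotate (Circle.exp (-(2 * Real.pi * θ)) ^ n.toAdd) f := by
  have h : ∀ k : ℤ, ∀ z, (rotationAut θ ^ k) f z =
      f (Circle.exp (-(2 * Real.pi * θ)) ^ k * z) := by
    intro k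
    induction k with
    | zero => intro z; simp
    | succ k ih =>
      intro z
      -- With the generator moved to the left, it acts last and only shifts the evaluation point, so
      -- the induction hypothesis applies there.
      rw [zpow_add_one, zpow_add_one, mul_assoc, (Commute.refl (rotationAut θ)).zpow_left k |>.eq]
      exact ih _
    | pred k ih =>
      intro z
      rw [zpow_sub_one, zpow_sub_one, mul_assoc,
        (Commute.refl (rotationAut θ)).inv_right.zpow_left (-k) |>.eq]
      exact ih _
  ext z
  exact h n.toAdd z

/-- The phases commute with the diagonal operator, and rotation by `s` commutes with the rotations
of the action. -/
theorem gaugeConj_regularRep (θ : ℝ) (s t : Circle) (f : C(Circle, ℂ)) :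
    gaugeConj s t (regularRep (rotationAction θ) mulRep f) =
      regularRep (rotationAction θ) mulRep (rotate s f) := by
  refine conjStarAlgEquiv_eq_of_comp_eq _ fun ξ => lp.ext (funext fun n => ?_)
  rw [gaugeUnitary_apply, regularRep_apply, regularRep_apply, gaugeUnitary_apply,
    rotationAction_apply, rotationAction_apply]
  refine (rotPhase_mulOp _ _ _ _).trans (congrArg (fun f => mulOp f _) ?_)
  ext z
  simp only [rotate_apply, mul_left_comm]

/-- The rotation is the same in every coordinate, so only the ratio of the phases at `n` and `n - k`
survives. -/
theorem gaugeConj_translation (s t : Circle) (k : Multiplicative ℤ) :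
    gaugeConj s t (translation L2S k) = ((t ^ k.toAdd : Circle) : ℂ) • translation L2S k := by
  refine conjStarAlgEquiv_eq_of_comp_eq _ fun ξ => lp.ext (funext fun n => ?_)
  change rotPhase s (t ^ n.toAdd) (ξ (k⁻¹ * n)) =
    ((t ^ k.toAdd : Circle) : ℂ) • rotPhase s (t ^ (k⁻¹ * n).toAdd) (ξ (k⁻¹ * n))
  rw [rotPhase_apply, rotPhase_apply, smul_smul, ← Circle.coe_mul, ← zpow_add]
  simp

theorem regularRep_mem (θ : ℝ) (f : C(Circle, ℂ)) :
    regularRep (rotationAction θ) mulRep f ∈ rotationAlgebra θ :=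
  StarSubalgebra.le_topologicalClosure _
    (StarAlgebra.subset_adjoin ℂ _ (.inl (Set.mem_range_self f)))

theorem translation_mem (θ : ℝ) (k : Multiplicative ℤ) :
    translation L2S k ∈ rotationAlgebra θ :=
  StarSubalgebra.le_topologicalClosure _
    (StarAlgebra.subset_adjoin ℂ _ (.inr (Set.mem_range_self k)))

theorem gaugeConj_mem {θ : ℝ} (s t : Circle) :
    ∀ x ∈ rotationAlgebra θ, gaugeConj s t x ∈ rotationAlgebra θ := by
  intro x hx
  refine adjoin_topologicalClosure_map_mem
    (gaugeConj s t : (HS →L[ℂ] HS) →⋆ₐ[ℂ] (HS →L[ℂ] HS)) ?_ hx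
  rintro _ (⟨f, rfl⟩ | ⟨k, rfl⟩)
  · exact (gaugeConj_regularRep θ s t f).symm ▸ regularRep_mem θ _
  · exact (gaugeConj_translation s t k).symm ▸
      (rotationAlgebra θ).smul_mem (translation_mem θ k) _

/-! ### The coordinate function as eigenunitary -/

/-- The coordinate function of the circle. -/
def coordFun : C(Circle, ℂ) := ⟨fun z => z, by fun_prop⟩

theorem coordFun_apply (z : Circle) : coordFun z = z := rfl

theorem regularRep_mul (θ : ℝ) (f g : C(Circle, ℂ)) :
    regularRep (rotationAction θ) mulRep (f * g) =
      regularRep (rotationAction θ) mulRep f * regularRep (rotationAction θ) mulRep g := by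
  ext1 ξ
  refine lp.ext (funext fun n => ?_)
  change mulRep _ _ = mulRep _ (mulRep _ _)
  rw [map_mul, map_mul]
  rfl

theorem regularRep_one (θ : ℝ) : regularRep (rotationAction θ) mulRep 1 = 1 := by
  ext1 ξ
  refine lp.ext (funext fun n => ?_)
  change mulRep _ _ = _
  rw [map_one, map_one]
  rfl

theorem regularRep_star (θ : ℝ) (f : C(Circle, ℂ)) :
    regularRep (rotationAction θ) mulRep (star f) =
      star (regularRep (rotationAction θ) mulRep f) := by
  rw [ContinuousLinearMap.star_eq_adjoint, ContinuousLinearMap.eq_adjoint_iff]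
  intro ξ η
  rw [lp.inner_eq_tsum, lp.inner_eq_tsum]
  refine tsum_congr fun n => ?_
  rw [regularRep_apply, regularRep_apply, map_star, map_star, ContinuousLinearMap.star_eq_adjoint,
    ContinuousLinearMap.adjoint_inner_left]

theorem star_coordFun_mul : star coordFun * coordFun = 1 := by
  ext z
  simp [coordFun_apply, ← Circle.coe_inv_eq_conj]

/-- The coordinate function as a unitary operator. -/
def coordOp (θ : ℝ) : unitary (HS →L[ℂ] HS) :=
  ⟨regularRep (rotationAction θ) mulRep coordFun, by
    rw [Unitary.mem_iff, ← regularRep_star, ← regularRep_mul, ← regularRep_mul,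
      mul_comm coordFun, star_coordFun_mul, regularRep_one]
    exact ⟨rfl, rfl⟩⟩

theorem coe_coordOp (θ : ℝ) :
    (coordOp θ : HS →L[ℂ] HS) = regularRep (rotationAction θ) mulRep coordFun := rfl

theorem gaugeConj_coordOp (θ : ℝ) (s t : Circle) :
    gaugeConj s t (coordOp θ) = (s : ℂ) • (coordOp θ : HS →L[ℂ] HS) := by
  rw [coe_coordOp, gaugeConj_regularRep]
  have h : rotate s coordFun = (s : ℂ) • coordFun := by
    ext z
    simp [rotate_apply, coordFun_apply]
  rw [h]
  ext1 ξ
  refine lp.ext (funext fun n => ?_)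
  change mulRep _ _ = (s : ℂ) • mulRep _ _
  rw [map_smul, map_smul]
  rfl

/-- The defining commutation relation of the rotation algebra: its scalar is the gauge phase of
`λ_k` at `t = e^{-2πiθ}`, which makes that gauge automorphism inner. -/
theorem translation_coordFun (θ : ℝ) (k : Multiplicative ℤ) :
    translation L2S k * regularRep (rotationAction θ) mulRep coordFun =
      ((Circle.exp (-(2 * Real.pi * θ)) ^ k.toAdd : Circle) : ℂ) •
        (regularRep (rotationAction θ) mulRep coordFun * translation L2S k) := by
  ext1 ξ
  refine lp.ext (funext fun n => ?_)
  change mulRep (rotationAction θ (k⁻¹ * n)⁻¹ coordFun) (ξ (k⁻¹ * n)) =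
    ((Circle.exp (-(2 * Real.pi * θ)) ^ k.toAdd : Circle) : ℂ) •
      mulRep (rotationAction θ n⁻¹ coordFun) (ξ (k⁻¹ * n))
  rw [← smul_apply, ← map_smul]
  congr 2
  rw [rotationAction_apply, rotationAction_apply]
  ext z
  simp only [rotate_apply, coordFun_apply, ContinuousMap.smul_apply, smul_eq_mul]
  rw [← Circle.coe_mul, ← mul_assoc, ← zpow_add]
  simp [add_comm]

theorem coordOp_mul_gaugeConj (θ : ℝ) : ∀ x ∈ rotationAlgebra θ,
    (coordOp θ : HS →L[ℂ] HS) * gaugeConj 1 (Circle.exp (-(2 * Real.pi * θ))) x =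
      x * coordOp θ := by
  intro x hx
  refine mul_apply_eq_mul_of_adjoin
    (gaugeConj 1 (Circle.exp (-(2 * Real.pi * θ))) : (HS →L[ℂ] HS) →⋆ₐ[ℂ] (HS →L[ℂ] HS))
    (coordOp θ) ?_ hx
  rintro _ (⟨f, rfl⟩ | ⟨k, rfl⟩)
  · have h : rotate 1 f = f := by
      ext z
      rw [rotate_apply, one_mul]
    have h1 := gaugeConj_regularRep θ 1 (Circle.exp (-(2 * Real.pi * θ))) f
    rw [h] at h1
    refine (congrArg _ h1).trans ?_
    rw [coe_coordOp, ← regularRep_mul, ← regularRep_mul, mul_comm]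
  · refine (congrArg _ (gaugeConj_translation 1 _ k)).trans ?_
    rw [mul_smul_comm]
    exact (translation_coordFun θ k).symm

end Rotation

end

theorem corollary3p3 (θ : ℝ) (hθ : Irrational θ) (m : ℕ) (hm : 1 ≤ m)
    (ω : Multiplicative (ZMod m) → Multiplicative (ZMod m) → Multiplicative (ZMod m) → Circle)
    (hω : IsThreeCocycle ω) :
    Nonempty (AnomalousAction ω (rotationAlgebra θ)) := by
  have : NeZero m := ⟨by omega⟩
  -- The m-th root makes the m-th power of the generating gauge automorphism the inner one given by
  -- `u`.
  have hr : Circle.exp (-(2 * Real.pi * θ) / m) ^ m = Circle.exp (-(2 * Real.pi * θ)) := by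
    rw [← Circle.exp_natCast_mul, mul_div_cancel₀ _ (Nat.cast_ne_zero.2 (NeZero.ne m))]
  refine AnomalousAction.nonempty_of_restrict_gauge (rotationAlgebra θ) hω gaugeConj
    gaugeConj_gaugeConj gaugeConj_one gaugeConj_mem (coordOp θ) (regularRep_mem θ _)
    (gaugeConj_coordOp θ) (Circle.exp (-(2 * Real.pi * θ) / m)) ?_
  rw [hr]
  exact coordOp_mul_gaugeConj θ
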